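/- **Setting.** Let $n_x,n_u\ge 1$ and consider $x(k+1)=f(x(k),u(k))$ with $x\in\mathbb R^{n_x}$, inputs $u\in\mathcal U(x)\subseteq\mathbb R^{n_u}$, $\mathcal U(x)\ne\emptyset$, and a stage cost $\ell:\mathbb R^{n_x}\times\mathbb R^{n_u}\to[0,\infty)$. For a feedback law $h$ with closed-loop solution $\phi(k,x,h)$, put $J(x,h)=\sum_{k\ge0}\ell(\phi(k,x,h),h(\phi(k,x,h)))\in[0,\infty]$, and let $J(x,\mathbf u)$ be the analogous cost of an input sequence $\mathbf u$. Let $h^0$ be an admissible feedback law, i.e. $h^0(x)\in\mathcal U(x)$ for all $x$. The algorithm PI$^+$ sets $V_r^0=J(\cdot,h^0)$, $H^0=H_r^0=H_r^{\star,0}=\{h^0\}$ and, for $i\ge 0$, $$H^{i+1}(x)=\operatorname*{argmin}_{u\in\mathcal U(x)}\{\ell(x,u)+V_r^i(f(x,u))\},\qquad H_r^{i+1}(x)=\bigcap_{\delta>0}\overline{H^{i+1}(x+\delta\mathbb B)},$$ $$V_r^{i+1}(x)=\min_{h\in H_r^{i+1}}J(x,h),\qquad H_r^{\star,i+1}(x)=\operatorname*{argmin}_{u\in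 H_r^{i+1}(x)}\{\ell(x,u)+V_r^{i+1}(f(x,u))\},$$ where $\mathbb B$ is the closed unit ball and $h\in H_r^{i+1}$ means that $h$ is a selection of $H_r^{i+1}$. **Assumptions.** $\sigma:\mathbb R^{n_x}\to[0,\infty)$ is continuous, and: 1. for every $x$ there is an admissible input sequence of finite cost that minimizes $J(x,\cdot)$ among the admissible input sequences; 2. there are a continuous $W:\mathbb R^{n_x}\to[0,\infty)$, functions $\alpha_W,\chi_W\in\mathcal K_\infty$ and a continuous nondecreasing $\overline\alpha_W:[0,\infty)\to[0,\infty)$ with $\overline\alpha_W(0)=0$ such that, for all $x$ and all $u\in\mathcal U(x)$, $W(x)\le\overline\alpha_W(\sigma(x))$ and $W(f(x,u))-W(x)\le-\alpha_W(\sigma(x))+\chi_W(\ell(x,u))$; 3. there is $\overline\alpha_V\in\mathcal K_\infty$ with $J(x,h^0)\le\overline\alpha_V(\sigma(x))$ for all $x$; 4. $f$ and $\ell$ are continuous; $\ell$ is level-bounded in $u$, locally uniformly in $x$ (for all $x\in\mathbb R^{n_x}$ and $\alpha\in\mathbb R$ there are a neighbourhood $\mathcal S$ of $x$ and a bounded $B\subset\mathbb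 R^{n_u}$ with $\{u:\ell(z,u)\le\alpha\}\subseteq B$ for all $z\in\mathcal S$); $\mathcal U$ is outer semicontinuous; $V_r^0$ is lower semicontinuous; $\{x:\sigma(x)\le\Delta\}$ is compact for every $\Delta>0$; 5. there are $c_W,a_W,\overline a_V>0$ and $\overline a_W\ge0$ such that, for all $s\ge0$, $\chi_W(s)\le c_Ws$, $\alpha_W(s)\ge a_Ws$, $\overline\alpha_V(s)\le\overline a_Vs$ and $\overline\alpha_W(s)\le\overline a_Ws$. **Conclusion.** Put $$a_Y=\underline a_Y=\frac{a_W}{c_W},\qquad \overline a_Y=\overline a_V+\frac{\overline a_W}{c_W},\qquad \widetilde a_Y=\frac{a_Y}{\overline a_Y},\qquad \beta(s,k)=\frac{\overline a_Y}{\underline a_Y}(1-\widetilde a_Y)^k s\quad(s,k\ge0),$$ where $0^0=1$. Then the algorithm is well defined: for all $i\ge0$ and $x$, the sets $H^i(x)$, $H_r^i(x)$, $H_r^{\star,i}(x)$ are nonempty and some selection $h$ of $H_r^i$ satisfies $J(x,h)=V_r^i(x)$. Moreover $0<\widetilde a_Y\le1$ and $\beta\in\mathcal{KL}$; if $\widetilde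 a_Y<1$, then $\beta$ is of class $\exp$-$\mathcal{KL}$, that is, $\beta(s,k)=\lambda_1se^{-\lambda_2k}$ with some $\lambda_1\ge1$, $\lambda_2>0$; and in all cases $\beta$ is bounded above by a function of class $\exp$-$\mathcal{KL}$. Finally, for every $i\in\mathbb Z_{\ge0}$, every $x\in\mathbb R^{n_x}$, every solution $\phi^i$ of $$x(k+1)\in f\big(x(k),H_r^{\star,i}(x(k))\big),\qquad x(0)=x,$$ and every $k\in\mathbb Z_{\ge0}$, $$\sigma(\phi^i(k))\le\beta(\sigma(x),k),$$ with the same $\beta$ for all iterations $i$. Here $\mathcal K_\infty$ is the class of continuous, strictly increasing, unbounded functions $[0,\infty)\to[0,\infty)$ vanishing at $0$; $\mathcal{KL}$ is the class of functions $\beta:[0,\infty)^2\to[0,\infty)$ that are nondecreasing in the first argument, nonincreasing in the second, with $\lim_{s\to0^+}\beta(s,t)=0$ for all $t$ and $\lim_{t\to\infty}\beta(s,t)=0$ for all $s$. -/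

import Mathlib

open Filter Topology
open scoped NNReal ENNReal

noncomputable section

namespace PIPlus

/-- `ℝⁿ` with its Euclidean norm. -/
abbrev Vec (n : ℕ) : Type := EuclideanSpace ℝ (Fin n)

/-- Class `𝒦∞`: continuous, zero at zero, strictly increasing and unbounded. -/
structure IsClassKInf (α : ℝ≥0 → ℝ≥0) : Prop where
  continuous : Continuous α
  zero : α 0 = 0
  strictMono : StrictMono α
  unbounded : Tendsto α atTop atTop

/-- Class `𝒦ℒ` (only the values at nonnegative arguments matter): nonnegative, nondecreasing in the
first argument, nonincreasing in the second one, vanishing as the first argument tends to `0⁺`, and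
vanishing as the second one tends to `∞`. -/
structure IsClassKL (β : ℝ → ℝ → ℝ) : Prop where
  nonneg : ∀ s t : ℝ, 0 ≤ s → 0 ≤ t → 0 ≤ β s t
  mono : ∀ s s' t : ℝ, 0 ≤ s → s ≤ s' → 0 ≤ t → β s t ≤ β s' t
  anti : ∀ s t t' : ℝ, 0 ≤ s → 0 ≤ t → t ≤ t' → β s t' ≤ β s t
  tendsto_left : ∀ t : ℝ, 0 ≤ t → Tendsto (fun s => β s t) (𝓝[>] 0) (𝓝 0)
  tendsto_right : ∀ s : ℝ, 0 ≤ s → Tendsto (fun t => β s t) atTop (𝓝 0)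

/-- Class `exp-𝒦ℒ`: `β(s,t) = c s exp(-r t)` for `s, t ≥ 0`, with `c ≥ 1` and `r > 0`. -/
def IsExpKL (β : ℝ → ℝ → ℝ) : Prop :=
  ∃ c r : ℝ, 1 ≤ c ∧ 0 < r ∧ ∀ s t : ℝ, 0 ≤ s → 0 ≤ t → β s t = c * s * Real.exp (-r * t)

/-- Outer semicontinuity of a set-valued map: limits of `uₖ ∈ S(xₖ)` with `xₖ → x` lie in `S(x)`. -/
def OuterSemicontinuous {n m : ℕ} (S : Vec n → Set (Vec m)) : Prop :=
  ∀ (x : Vec n) (u : Vec m) (xs : ℕ → Vec n) (us : ℕ → Vec m),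
    Tendsto xs atTop (𝓝 x) → Tendsto us atTop (𝓝 u) → (∀ k, us k ∈ S (xs k)) → u ∈ S x

/-- `g(x,u)` is level-bounded in `u`, locally uniformly in `x`. -/
def LevelBoundedLocallyUniform {n m : ℕ} (g : Vec n → Vec m → ℝ≥0) : Prop :=
  ∀ (x : Vec n) (a : ℝ), ∃ S ∈ 𝓝 x, ∃ B : Set (Vec m), Bornology.IsBounded B ∧
    ∀ z ∈ S, {u : Vec m | (g z u : ℝ) ≤ a} ⊆ B

/-- `h` is a selection of the set-valued map `S`. -/
def IsSelection {n m : ℕ} (S : Vec n → Set (Vec m)) (h : Vec n → Vec m) : Prop :=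
  ∀ x, h x ∈ S x

/-- The set of minimizers of `g` over `S`. -/
def argminOn {m : ℕ} (S : Set (Vec m)) (g : Vec m → ℝ≥0∞) : Set (Vec m) :=
  {u | u ∈ S ∧ ∀ v ∈ S, g u ≤ g v}

/-- A discrete-time optimal control problem: dynamics `x⁺ = f(x,u)`, nonnegative stage cost `ℓ`, and
nonempty sets `U(x)` of admissible inputs. -/
structure ControlProblem (nx nu : ℕ) where
  f : Vec nx → Vec nu → Vec nx
  ℓ : Vec nx → Vec nu → ℝ≥0
  U : Vec nx → Set (Vec nu)
  U_nonempty : ∀ x, (U x).Nonempty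

namespace ControlProblem

variable {nx nu : ℕ} (P : ControlProblem nx nu)

/-- The solution started at `x` under the input sequence `u`. -/
def openTraj (x : Vec nx) (u : ℕ → Vec nu) : ℕ → Vec nx
  | 0 => x
  | k + 1 => P.f (openTraj x u k) (u k)

/-- The infinite-horizon cost of an input sequence. -/
def openCost (x : Vec nx) (u : ℕ → Vec nu) : ℝ≥0∞ :=
  ∑' k, (P.ℓ (P.openTraj x u k) (u k) : ℝ≥0∞)

/-- The input sequence `u` is admissible from the initial state `x`. -/
def IsAdmissible (x : Vec nx) (u : ℕ → Vec nu) : Prop :=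
  ∀ k, u k ∈ P.U (P.openTraj x u k)

/-- From every initial state there is an optimal admissible input sequence, of finite cost. -/
def WellPosed : Prop :=
  ∀ x, ∃ u, P.IsAdmissible x u ∧ P.openCost x u < ∞ ∧
    ∀ v, P.IsAdmissible x v → P.openCost x u ≤ P.openCost x v

/-- The solution started at `x` under the feedback law `h`. -/
def traj (h : Vec nx → Vec nu) (x : Vec nx) : ℕ → Vec nx
  | 0 => x
  | k + 1 => P.f (traj h x k) (h (traj h x k))

/-- The cost `J(x,h)` induced by the feedback law `h` at the initial state `x`. -/
def J (x : Vec nx) (h : Vec nx → Vec nu) : ℝ≥0∞ :=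
  ∑' k, (P.ℓ (P.traj h x k) (h (P.traj h x k)) : ℝ≥0∞)

/-- Policy improvement: the minimizers of `u ↦ ℓ(x,u) + V(f(x,u))` over `U(x)`. -/
def improve (V : Vec nx → ℝ≥0∞) (x : Vec nx) : Set (Vec nu) :=
  argminOn (P.U x) fun u => (P.ℓ x u : ℝ≥0∞) + V (P.f x u)

end ControlProblem

/-- Policy regularization: `⋂_{δ>0} closure (H(x + δ𝔹))`, with `𝔹` the closed unit ball. -/
def regularize {n m : ℕ} (H : Vec n → Set (Vec m)) (x : Vec n) : Set (Vec m) :=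
  ⋂ (δ : ℝ) (_ : 0 < δ), closure (⋃ y ∈ Metric.closedBall x δ, H y)

namespace ControlProblem

variable {nx nu : ℕ} (P : ControlProblem nx nu)

/-- Policy evaluation: the least cost `J(x,h)` over all selections `h` of `S`. -/
def evaluate (S : Vec nx → Set (Vec nu)) (x : Vec nx) : ℝ≥0∞ :=
  ⨅ (h : Vec nx → Vec nu) (_ : IsSelection S h), P.J x h

/-- The value function `V_r^i` of PI⁺ started at the policy `h0`. -/
def Vr (h0 : Vec nx → Vec nu) : ℕ → Vec nx → ℝ≥0∞
  | 0 => fun x => P.J x h0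
  | i + 1 => P.evaluate (regularize (P.improve (Vr h0 i)))

/-- The set-valued map `H^i` of PI⁺. -/
def H (h0 : Vec nx → Vec nu) : ℕ → Vec nx → Set (Vec nu)
  | 0 => fun x => {h0 x}
  | i + 1 => P.improve (P.Vr h0 i)

/-- The regularized set-valued map `H_r^i` of PI⁺. -/
def Hr (h0 : Vec nx → Vec nu) : ℕ → Vec nx → Set (Vec nu)
  | 0 => fun x => {h0 x}
  | i + 1 => regularize (P.H h0 (i + 1))

/-- The set-valued map `H_r^{⋆,i}` of PI⁺, from which the policy of iteration `i` is selected. -/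
def Hstar (h0 : Vec nx → Vec nu) : ℕ → Vec nx → Set (Vec nu)
  | 0 => fun x => {h0 x}
  | i + 1 => fun x =>
      argminOn (P.Hr h0 (i + 1) x) fun u => (P.ℓ x u : ℝ≥0∞) + P.Vr h0 (i + 1) (P.f x u)

/-- `φ` solves the closed-loop inclusion `x(k+1) ∈ f(x(k), H_r^{⋆,i}(x(k)))`. -/
def IsSolution (h0 : Vec nx → Vec nu) (i : ℕ) (φ : ℕ → Vec nx) : Prop :=
  ∀ k, ∃ u ∈ P.Hstar h0 i (φ k), φ (k + 1) = P.f (φ k) u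

/-- Detectability of the system and stage cost with respect to `σ`. -/
structure Detectable (σ W : Vec nx → ℝ≥0) (αW χW αWbar : ℝ≥0 → ℝ≥0) : Prop where
  continuous_W : Continuous W
  kInf_αW : IsClassKInf αW
  kInf_χW : IsClassKInf χW
  continuous_αWbar : Continuous αWbar
  monotone_αWbar : Monotone αWbar
  αWbar_zero : αWbar 0 = 0
  W_le : ∀ x, W x ≤ αWbar (σ x)
  dissipation : ∀ x, ∀ u ∈ P.U x,
    (W (P.f x u) : ℝ) - (W x : ℝ) ≤ -(αW (σ x) : ℝ) + (χW (P.ℓ x u) : ℝ)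

/-- The regularity conditions on the data, the initial cost and `σ`. -/
structure FeasibilityAssumption (h0 : Vec nx → Vec nu) (σ : Vec nx → ℝ≥0) : Prop where
  continuous_f : Continuous fun p : Vec nx × Vec nu => P.f p.1 p.2
  continuous_ℓ : Continuous fun p : Vec nx × Vec nu => P.ℓ p.1 p.2
  levelBounded : LevelBoundedLocallyUniform P.ℓ
  osc_U : OuterSemicontinuous P.U
  lsc_V0 : LowerSemicontinuous fun x => P.J x h0
  compact_sublevel : ∀ Δ : ℝ≥0, 0 < Δ → IsCompact {x | σ x ≤ Δ}

end ControlProblem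

end PIPlus

end

namespace PIPlus

open Filter Topology
open scoped NNReal ENNReal

/-! The function `Y = V_r^i + W / cW` is a Lyapunov function for iteration `i`, with constants
independent of `i`: `aY σ ≤ Y ≤ aYup σ`, and `Y` drops by at least `aY σ` under every input of
`H_r^{⋆,i}`. Hence `Y` contracts by `1 - aY / aYup` at each step.

Uniformity in `i` comes from `V_r^i ≤ V_r^0`: the regularized map contains the greedy inputs, so its
evaluation cannot raise the cost (`evaluate_le`). The decrease of `V_r^i` by the stage cost is a
Bellman equation, available because one selection is optimal from all initial states at once
(`exists_optimal_selection`). That selection is built from limits of finite-horizon values: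
regularization gives outer semicontinuity, and level-boundedness then gives compact sublevel sets.
The same facts make `V_r^{i+1}` lower semicontinuous, so the next improvement step has minimizers
and the induction (`IterationInvariant.succ`) continues. -/

/-! ### Outer semicontinuity, regularization and parametric minimization. -/

theorem outerSemicontinuous_regularize {n m : ℕ} (H : Vec n → Set (Vec m)) :
    OuterSemicontinuous (regularize H) := by
  intro x u xs us hx hu hmem
  simp only [regularize, Set.mem_iInter] at hmem ⊢
  intro δ hδ
  refine isClosed_closure.mem_of_tendsto hu ?_
  filter_upwards [hx (Metric.closedBall_mem_nhds x (half_pos hδ))] with k hk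
  refine closure_mono (Set.biUnion_subset_biUnion_left ?_) (hmem k (δ / 2) (half_pos hδ))
  refine Metric.closedBall_subset_closedBall' ?_
  have := Metric.mem_closedBall.1 hk
  linarith

theorem subset_regularize {n m : ℕ} (H : Vec n → Set (Vec m)) (x : Vec n) :
    H x ⊆ regularize H x := by
  intro u hu
  simp only [regularize, Set.mem_iInter]
  exact fun δ hδ => subset_closure (Set.mem_biUnion (Metric.mem_closedBall_self hδ.le) hu)

/-- Points of the regularization are limits of values of `H` at points tending to `x`. Taking `S =
U` keeps regularized inputs admissible, as the dissipation inequality requires. -/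
theorem regularize_subset {n m : ℕ} {H S : Vec n → Set (Vec m)} (hS : OuterSemicontinuous S)
    (hHS : ∀ x, H x ⊆ S x) (x : Vec n) : regularize H x ⊆ S x := by
  intro u hu
  simp only [regularize, Set.mem_iInter] at hu
  have key : ∀ k : ℕ, ∃ y v, dist y x ≤ 1 / ((k : ℝ) + 1) ∧ v ∈ H y ∧
      dist v u ≤ 1 / ((k : ℝ) + 1) := by
    intro k
    have hk : 0 < 1 / ((k : ℝ) + 1) := Nat.one_div_pos_of_nat
    obtain ⟨v, hv, hd⟩ := Metric.mem_closure_iff.1 (hu _ hk) _ hk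
    obtain ⟨y, hy, hvy⟩ := Set.mem_iUnion₂.1 hv
    exact ⟨y, v, hy, hvy, by rw [dist_comm]; exact hd.le⟩
  choose ys vs hy hv hd using key
  have lim := tendsto_one_div_add_atTop_nhds_zero_nat (𝕜 := ℝ)
  exact hS x u ys vs
    (tendsto_iff_dist_tendsto_zero.2 (squeeze_zero (fun _ => dist_nonneg) hy lim))
    (tendsto_iff_dist_tendsto_zero.2 (squeeze_zero (fun _ => dist_nonneg) hd lim))
    (fun k => hHS _ (hv k))

theorem OuterSemicontinuous.isClosed {n m : ℕ} {S : Vec n → Set (Vec m)}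
    (hS : OuterSemicontinuous S) (x : Vec n) : IsClosed (S x) :=
  IsSeqClosed.isClosed fun us u hus hu =>
    hS x u (fun _ => x) us tendsto_const_nhds hu hus

/-- Parametric minimization of a lower semicontinuous cost over an outer semicontinuous map. -/
theorem lowerSemicontinuous_iInf {n m : ℕ} {S : Vec n → Set (Vec m)}
    (hS : OuterSemicontinuous S) {g : Vec n → Vec m → ℝ≥0}
    (hg : LevelBoundedLocallyUniform g) {q : Vec n → Vec m → ℝ≥0∞}
    (hq : LowerSemicontinuous fun p : Vec n × Vec m => q p.1 p.2)
    (hgq : ∀ x u, (g x u : ℝ≥0∞) ≤ q x u) :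
    LowerSemicontinuous fun x => ⨅ u ∈ S x, q x u := by
  intro x y hy
  by_contra hne
  -- The gap between `y` and `c` supplies inputs of cost at most `c` without assuming that the
  -- infima are attained; `c` is finite, so level-boundedness applies.
  obtain ⟨c, hyc, hcx⟩ := exists_between hy
  have hc : c ≠ ∞ := ne_top_of_lt hcx
  obtain ⟨T, hT, B, hB, hTB⟩ := hg x c.toReal
  have hfreq : ∃ᶠ z in 𝓝 x, ∃ u, u ∈ S z ∧ q z u ≤ c ∧ u ∈ B := by
    refine ((not_eventually.1 hne).and_eventually hT).mono ?_
    rintro z ⟨hz, hzT⟩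
    have hlt : (⨅ u ∈ S z, q z u) < c := (not_lt.1 hz).trans_lt hyc
    simp only [iInf_lt_iff] at hlt
    obtain ⟨u, hu, hqu⟩ := hlt
    refine ⟨u, hu, hqu.le, hTB z hzT ?_⟩
    have := ENNReal.toReal_mono hc ((hgq z u).trans hqu.le)
    simpa using this
  obtain ⟨zs, hzs, hex⟩ := exists_seq_forall_of_frequently hfreq
  choose us hus hqs hBs using hex
  obtain ⟨u, -, θ, hθ, hlim⟩ := tendsto_subseq_of_bounded hB hBs
  have hz' : Tendsto (zs ∘ θ) atTop (𝓝 x) := hzs.comp hθ.tendsto_atTop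
  have huS : u ∈ S x := hS x u (zs ∘ θ) (us ∘ θ) hz' hlim fun k => hus _
  have hcl : IsClosed {p : Vec n × Vec m | q p.1 p.2 ≤ c} := hq.isClosed_preimage c
  have hmem : q x u ≤ c :=
    hcl.mem_of_tendsto (hz'.prodMk_nhds hlim) (Eventually.of_forall fun k => hqs (θ k))
  exact absurd hcx (not_lt.2 ((iInf₂_le u huS).trans hmem))

/-- Since `q` dominates `g`, its finite sublevel sets inherit boundedness from `g`; closedness comes
from the semicontinuity of `S` and `q`. -/
theorem isCompact_sublevel {n m : ℕ} {S : Vec n → Set (Vec m)}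
    (hS : OuterSemicontinuous S) {g : Vec n → Vec m → ℝ≥0}
    (hg : LevelBoundedLocallyUniform g) {q : Vec n → Vec m → ℝ≥0∞}
    (hq : LowerSemicontinuous fun p : Vec n × Vec m => q p.1 p.2)
    (hgq : ∀ x u, (g x u : ℝ≥0∞) ≤ q x u) (x : Vec n) {c : ℝ≥0∞} (hc : c ≠ ∞) :
    IsCompact {u | u ∈ S x ∧ q x u ≤ c} := by
  obtain ⟨T, hT, B, hB, hTB⟩ := hg x c.toReal
  have hqx : LowerSemicontinuous fun u => q x u :=
    hq.comp (g := fun u : Vec m => (x, u)) (by fun_prop)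
  refine Metric.isCompact_of_isClosed_isBounded
    ((hS.isClosed x).inter (hqx.isClosed_preimage c)) (hB.subset ?_)
  rintro u ⟨-, hu⟩
  refine hTB x (mem_of_mem_nhds hT) ?_
  have := ENNReal.toReal_mono hc ((hgq x u).trans hu)
  simpa using this

theorem argminOn_nonempty {n m : ℕ} {S : Vec n → Set (Vec m)}
    (hS : OuterSemicontinuous S) {g : Vec n → Vec m → ℝ≥0}
    (hg : LevelBoundedLocallyUniform g) {q : Vec n → Vec m → ℝ≥0∞}
    (hq : LowerSemicontinuous fun p : Vec n × Vec m => q p.1 p.2)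
    (hgq : ∀ x u, (g x u : ℝ≥0∞) ≤ q x u) (x : Vec n) (hne : (S x).Nonempty) :
    (argminOn (S x) (q x)).Nonempty := by
  obtain ⟨u₀, hu₀⟩ := hne
  by_cases htop : ∀ u ∈ S x, q x u = ∞
  · exact ⟨u₀, hu₀, fun v hv => by rw [htop v hv]; exact le_top⟩
  push Not at htop
  obtain ⟨u₁, hu₁, hfin⟩ := htop
  have hqx : LowerSemicontinuous fun u => q x u :=
    hq.comp (g := fun u : Vec m => (x, u)) (by fun_prop)
  obtain ⟨u, hu, hmin⟩ := LowerSemicontinuousOn.exists_isMinOn (f := q x)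
    (s := {u | u ∈ S x ∧ q x u ≤ q x u₁}) ⟨u₁, hu₁, le_rfl⟩
    (isCompact_sublevel hS hg hq hgq x hfin) (hqx.lowerSemicontinuousOn _)
  refine ⟨u, hu.1, fun v hv => ?_⟩
  by_cases hvc : q x v ≤ q x u₁
  · exact hmin ⟨hv, hvc⟩
  · exact hu.2.trans (not_le.1 hvc).le

theorem iInf_eq_of_mem_argminOn {m : ℕ} {S : Set (Vec m)} {g : Vec m → ℝ≥0∞} {u : Vec m}
    (hu : u ∈ argminOn S g) : ⨅ v ∈ S, g v = g u :=
  le_antisymm (iInf₂_le u hu.1) (le_iInf₂ hu.2)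

/-! ### Bellman equations and finite-horizon values. -/

namespace ControlProblem

variable {nx nu : ℕ} (P : ControlProblem nx nu)

/-- The cost of applying `u` at `x` and paying `V` afterwards. -/
def stage (V : Vec nx → ℝ≥0∞) (x : Vec nx) (u : Vec nu) : ℝ≥0∞ :=
  (P.ℓ x u : ℝ≥0∞) + V (P.f x u)

/-- The finite-horizon value functions for inputs constrained to `S`. -/
noncomputable def valueIter (S : Vec nx → Set (Vec nu)) : ℕ → Vec nx → ℝ≥0∞
  | 0 => fun _ => 0
  | N + 1 => fun x => ⨅ u ∈ S x, P.stage (valueIter S N) x u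

/-- Continuity of the data and level-boundedness of the stage cost. -/
structure Regular : Prop where
  continuous_f : Continuous fun p : Vec nx × Vec nu => P.f p.1 p.2
  continuous_ℓ : Continuous fun p : Vec nx × Vec nu => P.ℓ p.1 p.2
  levelBounded : LevelBoundedLocallyUniform P.ℓ

variable {P}

theorem stage_mono {V V' : Vec nx → ℝ≥0∞} (h : ∀ x, V x ≤ V' x) (x : Vec nx) (u : Vec nu) :
    P.stage V x u ≤ P.stage V' x u :=
  add_le_add le_rfl (h _)

theorem le_stage (V : Vec nx → ℝ≥0∞) (x : Vec nx) (u : Vec nu) :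
    (P.ℓ x u : ℝ≥0∞) ≤ P.stage V x u :=
  le_self_add

theorem Regular.lowerSemicontinuous_stage (hP : P.Regular) {V : Vec nx → ℝ≥0∞}
    (hV : LowerSemicontinuous V) :
    LowerSemicontinuous fun p : Vec nx × Vec nu => P.stage V p.1 p.2 :=
  (ENNReal.continuous_coe.comp hP.continuous_ℓ).lowerSemicontinuous.add
    (hV.comp hP.continuous_f)

theorem Regular.argminOn_stage_nonempty (hP : P.Regular) {V : Vec nx → ℝ≥0∞}
    (hV : LowerSemicontinuous V) {S : Vec nx → Set (Vec nu)} (hS : OuterSemicontinuous S)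
    (x : Vec nx) (hne : (S x).Nonempty) : (argminOn (S x) (P.stage V x)).Nonempty :=
  argminOn_nonempty hS hP.levelBounded (hP.lowerSemicontinuous_stage hV) (le_stage V) x hne

theorem Regular.lowerSemicontinuous_valueIter (hP : P.Regular) {S : Vec nx → Set (Vec nu)}
    (hS : OuterSemicontinuous S) (N : ℕ) : LowerSemicontinuous (P.valueIter S N) := by
  induction N with
  | zero => exact lowerSemicontinuous_const
  | succ N ih =>
    exact lowerSemicontinuous_iInf hS hP.levelBounded (hP.lowerSemicontinuous_stage ih)
      (le_stage _)

theorem valueIter_le_succ (S : Vec nx → Set (Vec nu)) (N : ℕ) (x : Vec nx) :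
    P.valueIter S N x ≤ P.valueIter S (N + 1) x := by
  induction N generalizing x with
  | zero => exact zero_le
  | succ N ih => exact iInf₂_mono fun u _ => stage_mono ih x u

theorem traj_succ (h : Vec nx → Vec nu) (x : Vec nx) (k : ℕ) :
    P.traj h x (k + 1) = P.traj h (P.f x (h x)) k := by
  induction k with
  | zero => rfl
  | succ k ih =>
    change P.f (P.traj h x (k + 1)) (h (P.traj h x (k + 1))) = _
    rw [ih]
    rfl

theorem J_eq_stage (x : Vec nx) (h : Vec nx → Vec nu) :
    P.J x h = P.stage (fun y => P.J y h) x (h x) := by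
  unfold J stage
  rw [tsum_eq_zero_add' ENNReal.summable]
  simp only [traj_succ]
  rfl

theorem sum_range_cost_succ (x : Vec nx) (h : Vec nx → Vec nu) (N : ℕ) :
    ∑ k ∈ Finset.range (N + 1), (P.ℓ (P.traj h x k) (h (P.traj h x k)) : ℝ≥0∞) =
      P.stage (fun y => ∑ k ∈ Finset.range N,
        (P.ℓ (P.traj h y k) (h (P.traj h y k)) : ℝ≥0∞)) x (h x) := by
  rw [Finset.sum_range_succ', add_comm]
  simp only [traj_succ]
  rfl

/-- A feedback law along which `V` decreases at least by the stage cost costs at most `V`. -/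
theorem J_le_of_stage_le {V : Vec nx → ℝ≥0∞} {h : Vec nx → Vec nu}
    (hV : ∀ x, P.stage V x (h x) ≤ V x) (x : Vec nx) : P.J x h ≤ V x := by
  refine ENNReal.tsum_le_of_sum_range_le fun N => ?_
  induction N generalizing x with
  | zero => simp
  | succ N ih =>
    rw [sum_range_cost_succ]
    exact (stage_mono ih x (h x)).trans (hV x)

theorem valueIter_le_J {S : Vec nx → Set (Vec nu)} {h : Vec nx → Vec nu} (hh : IsSelection S h)
    (N : ℕ) (x : Vec nx) : P.valueIter S N x ≤ P.J x h := by
  induction N generalizing x with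
  | zero => exact zero_le
  | succ N ih =>
    rw [J_eq_stage]
    exact (iInf₂_le (h x) (hh x)).trans (stage_mono ih x (h x))

/-- Compactness interchanges the minimum over inputs with the limit of horizons: the inputs whose
`N`-step continuation costs at most the limit value form nonempty compact sets decreasing in `N`,
and a common point works for the limit. -/
theorem Regular.exists_stage_iSup_valueIter_le (hP : P.Regular) {S : Vec nx → Set (Vec nu)}
    (hS : OuterSemicontinuous S) (x : Vec nx) (hne : (S x).Nonempty) :
    ∃ u ∈ S x, P.stage (fun y => ⨆ N, P.valueIter S N y) x u ≤ ⨆ N, P.valueIter S N x := by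
  by_cases htop : ⨆ N, P.valueIter S N x = ∞
  · obtain ⟨u, hu⟩ := hne
    exact ⟨u, hu, htop ▸ le_top⟩
  let K : ℕ → Set (Vec nu) := fun N =>
    {u | u ∈ S x ∧ P.stage (P.valueIter S N) x u ≤ ⨆ N, P.valueIter S N x}
  have hK : ∀ N, IsCompact (K N) := fun N =>
    isCompact_sublevel hS hP.levelBounded
      (hP.lowerSemicontinuous_stage (hP.lowerSemicontinuous_valueIter hS N)) (le_stage _) x htop
  obtain ⟨u, hu⟩ := IsCompact.nonempty_iInter_of_sequence_nonempty_isCompact_isClosed K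
    (fun N u hu => ⟨hu.1, (stage_mono (valueIter_le_succ S N) x u).trans hu.2⟩)
    (fun N => by
      obtain ⟨u, hu⟩ := hP.argminOn_stage_nonempty (hP.lowerSemicontinuous_valueIter hS N) hS x hne
      refine ⟨u, hu.1, ?_⟩
      rw [← iInf_eq_of_mem_argminOn hu]
      exact le_iSup (fun N => P.valueIter S N x) (N + 1))
    (hK 0) (fun N => (hK N).isClosed)
  rw [Set.mem_iInter] at hu
  refine ⟨u, (hu 0).1, ?_⟩
  rw [stage, ENNReal.add_iSup]
  exact iSup_le fun N => (hu N).2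

/-- The least cost over the selections of `S` is the limit of the finite-horizon values, and one
selection attains it from every initial state. -/
theorem Regular.exists_optimal_selection (hP : P.Regular) {S : Vec nx → Set (Vec nu)}
    (hS : OuterSemicontinuous S) (hne : ∀ x, (S x).Nonempty) :
    ∃ h, IsSelection S h ∧ ∀ x, P.J x h = P.evaluate S x ∧
      P.evaluate S x = ⨆ N, P.valueIter S N x := by
  choose h hh hle using fun x => hP.exists_stage_iSup_valueIter_le hS x (hne x)
  refine ⟨h, hh, fun x => ?_⟩
  -- The three inequalities form a cycle, hence are equalities.
  have h₁ : P.J x h ≤ ⨆ N, P.valueIter S N x := J_le_of_stage_le hle x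
  have h₂ : ⨆ N, P.valueIter S N x ≤ P.evaluate S x :=
    le_iInf₂ fun h' hh' => iSup_le fun N => valueIter_le_J hh' N x
  have h₃ : P.evaluate S x ≤ P.J x h := iInf₂_le h hh
  exact ⟨le_antisymm (h₁.trans h₂) h₃, le_antisymm (h₃.trans h₁) h₂⟩

theorem Regular.lowerSemicontinuous_evaluate (hP : P.Regular) {S : Vec nx → Set (Vec nu)}
    (hS : OuterSemicontinuous S) (hne : ∀ x, (S x).Nonempty) :
    LowerSemicontinuous (P.evaluate S) := by
  obtain ⟨h, -, hh⟩ := hP.exists_optimal_selection hS hne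
  rw [show P.evaluate S = fun x => ⨆ N, P.valueIter S N x from funext fun x => (hh x).2]
  exact lowerSemicontinuous_iSup fun N => hP.lowerSemicontinuous_valueIter hS N

/-- If `S` contains the greedy inputs for a cost `V` attained by an admissible feedback law `h`,
then evaluating `S` gives at most `V`. -/
theorem evaluate_le {S : Vec nx → Set (Vec nu)} {V : Vec nx → ℝ≥0∞} {h : Vec nx → Vec nu}
    (hh : IsSelection P.U h) (hJ : ∀ x, P.J x h = V x) (hne : ∀ x, (P.improve V x).Nonempty)
    (hsub : ∀ x, P.improve V x ⊆ S x) (x : Vec nx) : P.evaluate S x ≤ V x := by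
  choose g hg using hne
  refine (iInf₂_le g fun y => hsub y (hg y)).trans (J_le_of_stage_le (fun y => ?_) x)
  calc P.stage V y (g y) ≤ P.stage V y (h y) := (hg y).2 _ (hh y)
    _ = P.stage (fun z => P.J z h) y (h y) := by simp only [hJ]
    _ = V y := by rw [← J_eq_stage, hJ]

/-! ### Induction over the iterations. -/

/-- The invariants of an iteration of PI⁺. -/
structure IterationInvariant (P : ControlProblem nx nu) (h0 : Vec nx → Vec nu) (i : ℕ) :
    Prop where
  H_nonempty : ∀ x, (P.H h0 i x).Nonempty
  Hr_nonempty : ∀ x, (P.Hr h0 i x).Nonempty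
  Hstar_nonempty : ∀ x, (P.Hstar h0 i x).Nonempty
  Hr_subset : ∀ x, P.Hr h0 i x ⊆ P.U x
  Hstar_subset : ∀ x, P.Hstar h0 i x ⊆ P.U x
  exists_optimal : ∃ h, IsSelection (P.Hr h0 i) h ∧ ∀ x, P.J x h = P.Vr h0 i x
  lowerSemicontinuous_Vr : LowerSemicontinuous (P.Vr h0 i)
  Vr_le : ∀ x, P.Vr h0 i x ≤ P.J x h0
  stage_Hstar_le : ∀ x, ∀ u ∈ P.Hstar h0 i x, P.stage (P.Vr h0 i) x u ≤ P.Vr h0 i x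

theorem iterationInvariant_zero {h0 : Vec nx → Vec nu} (hh0 : IsSelection P.U h0)
    (hlsc : LowerSemicontinuous fun x => P.J x h0) : IterationInvariant P h0 0 where
  H_nonempty _ := Set.singleton_nonempty _
  Hr_nonempty _ := Set.singleton_nonempty _
  Hstar_nonempty _ := Set.singleton_nonempty _
  Hr_subset x := Set.singleton_subset_iff.2 (hh0 x)
  Hstar_subset x := Set.singleton_subset_iff.2 (hh0 x)
  exists_optimal := ⟨h0, fun _ => rfl, fun _ => rfl⟩
  lowerSemicontinuous_Vr := hlsc
  Vr_le _ := le_rfl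
  stage_Hstar_le x u hu := by
    obtain rfl : u = h0 x := hu
    exact (J_eq_stage x h0).ge

theorem IterationInvariant.succ (hP : P.Regular) (hU : OuterSemicontinuous P.U)
    {h0 : Vec nx → Vec nu} {i : ℕ} (hi : IterationInvariant P h0 i) :
    IterationInvariant P h0 (i + 1) := by
  have hH : ∀ x, (P.improve (P.Vr h0 i) x).Nonempty := fun x =>
    hP.argminOn_stage_nonempty hi.lowerSemicontinuous_Vr hU x (P.U_nonempty x)
  have hsub : ∀ x, P.Hr h0 (i + 1) x ⊆ P.U x :=
    regularize_subset hU fun _ _ hu => hu.1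
  have hsup : ∀ x, P.improve (P.Vr h0 i) x ⊆ P.Hr h0 (i + 1) x := subset_regularize _
  have hne : ∀ x, (P.Hr h0 (i + 1) x).Nonempty := fun x => (hH x).mono (hsup x)
  have hosc : OuterSemicontinuous (P.Hr h0 (i + 1)) := outerSemicontinuous_regularize _
  have hlsc : LowerSemicontinuous (P.Vr h0 (i + 1)) := hP.lowerSemicontinuous_evaluate hosc hne
  obtain ⟨h, hh, hopt⟩ := hP.exists_optimal_selection hosc hne
  have hJ : ∀ x, P.J x h = P.Vr h0 (i + 1) x := fun x => (hopt x).1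
  obtain ⟨g, hg, hgJ⟩ := hi.exists_optimal
  exact
    { H_nonempty := hH
      Hr_nonempty := hne
      Hstar_nonempty := fun x => hP.argminOn_stage_nonempty hlsc hosc x (hne x)
      Hr_subset := hsub
      Hstar_subset := fun x u hu => hsub x hu.1
      exists_optimal := ⟨h, hh, hJ⟩
      lowerSemicontinuous_Vr := hlsc
      Vr_le := fun x =>
        (evaluate_le (fun y => hi.Hr_subset y (hg y)) hgJ hH hsup x).trans (hi.Vr_le x)
      -- The optimal selection `h` competes in the argmin defining `H_r^⋆`, and it satisfies the
      -- Bellman equation with equality.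
      stage_Hstar_le := fun x u hu => by
        calc P.stage (P.Vr h0 (i + 1)) x u
            ≤ P.stage (P.Vr h0 (i + 1)) x (h x) := hu.2 _ (hh x)
          _ = P.stage (fun z => P.J z h) x (h x) := by simp only [hJ]
          _ = P.Vr h0 (i + 1) x := by rw [← J_eq_stage, hJ] }

theorem FeasibilityAssumption.regular {h0 : Vec nx → Vec nu} {σ : Vec nx → ℝ≥0}
    (h : P.FeasibilityAssumption h0 σ) : P.Regular :=
  ⟨h.continuous_f, h.continuous_ℓ, h.levelBounded⟩

theorem FeasibilityAssumption.iterationInvariant {h0 : Vec nx → Vec nu} {σ : Vec nx → ℝ≥0}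
    (h : P.FeasibilityAssumption h0 σ) (hh0 : IsSelection P.U h0) (i : ℕ) :
    IterationInvariant P h0 i := by
  induction i with
  | zero => exact iterationInvariant_zero hh0 h.lsc_V0
  | succ i ih => exact ih.succ h.regular h.osc_U

/-- If `σ` vanished identically, its compact sublevel set would be the whole space, which is
noncompact in positive dimension. -/
theorem FeasibilityAssumption.exists_pos {h0 : Vec nx → Vec nu} {σ : Vec nx → ℝ≥0}
    (h : P.FeasibilityAssumption h0 σ) (hnx : 0 < nx) : ∃ x, 0 < σ x := by
  by_contra! hσ
  have huniv : {x | σ x ≤ 1} = Set.univ :=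
    Set.eq_univ_of_forall fun x => (hσ x).trans zero_le
  have : Nonempty (Fin nx) := ⟨⟨0, hnx⟩⟩
  exact noncompact_univ (Vec nx) (huniv ▸ h.compact_sublevel 1 one_pos)

end ControlProblem

/-! ### Comparison functions and geometric decay. -/

theorem isClassKL_mul_rpow {c q : ℝ} (hc : 0 ≤ c) (hq0 : 0 ≤ q) (hq1 : q < 1) :
    IsClassKL fun s t => c * q ^ t * s where
  nonneg s t hs _ := by positivity
  mono s s' t _ hss _ := by gcongr
  anti s t t' hs ht htt := by
    have hpow : q ^ t' ≤ q ^ t := by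
      -- The base `q = 0` occurs when `aYtilde = 1`; then the power is `1` at time `0` and `0`
      -- afterwards.
      rcases hq0.eq_or_lt with rfl | hq
      · rcases ht.eq_or_lt with rfl | ht
        · rw [Real.rpow_zero]
          exact Real.rpow_le_one le_rfl zero_le_one htt
        · rw [Real.zero_rpow (ht.trans_le htt).ne', Real.zero_rpow ht.ne']
      · exact Real.rpow_le_rpow_of_exponent_ge hq hq1.le htt
    gcongr
  tendsto_left t _ := by
    have : Tendsto (fun s : ℝ => c * q ^ t * s) (𝓝 0) (𝓝 (c * q ^ t * 0)) :=
      (continuous_const.mul continuous_id).tendsto 0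
    rw [mul_zero] at this
    exact this.mono_left nhdsWithin_le_nhds
  tendsto_right s _ := by
    have := ((tendsto_rpow_atTop_of_base_lt_one q (by linarith) hq1).const_mul c).mul_const s
    simpa using this

theorem isExpKL_mul_rpow {c q : ℝ} (hc : 1 ≤ c) (hq0 : 0 < q) (hq1 : q < 1) :
    IsExpKL fun s t => c * q ^ t * s := by
  refine ⟨c, -Real.log q, hc, neg_pos.2 (Real.log_neg hq0 hq1), fun s t _ _ => ?_⟩
  simp only [Real.rpow_def_of_pos hq0, neg_neg]
  ring

theorem exists_isExpKL_mul_rpow_le {c q : ℝ} (hc : 1 ≤ c) (hq0 : 0 ≤ q) (hq1 : q < 1) :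
    ∃ β', IsExpKL β' ∧ ∀ s t : ℝ, 0 ≤ s → 0 ≤ t → c * q ^ t * s ≤ β' s t := by
  -- The midpoint of `q` and `1` is a positive base below `1`, even when `q = 0`.
  have hr0 : 0 < (q + 1) / 2 := by linarith
  refine ⟨_, isExpKL_mul_rpow hc hr0 (by linarith), fun s t hs ht => ?_⟩
  have hqr : q ≤ (q + 1) / 2 := by linarith
  gcongr

theorem le_pow_mul_of_succ_le {Y : ℕ → ℝ} {q : ℝ} (hq : 0 ≤ q) (h : ∀ k, Y (k + 1) ≤ q * Y k)
    (k : ℕ) : Y k ≤ q ^ k * Y 0 := by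
  induction k with
  | zero => simp
  | succ k ih =>
    calc Y (k + 1) ≤ q * Y k := h k
      _ ≤ q * (q ^ k * Y 0) := by gcongr
      _ = q ^ (k + 1) * Y 0 := by ring

end PIPlus

/-! ### The Lyapunov argument. -/

open PIPlus in
theorem mainTheorem11 {nx nu : ℕ} (hnx : 0 < nx) (hnu : 0 < nu)
    (P : ControlProblem nx nu)
    (h0 : Vec nx → Vec nu) (hh0 : IsSelection P.U h0)
    (σ : Vec nx → ℝ≥0) (hσ : Continuous σ)
    -- the standing assumptions
    (hwp : P.WellPosed)
    (W : Vec nx → ℝ≥0) (αW χW αWbar : ℝ≥0 → ℝ≥0)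
    (hdet : P.Detectable σ W αW χW αWbar)
    (αVbar : ℝ≥0 → ℝ≥0) (hαV : IsClassKInf αVbar)
    (hV0 : ∀ x, P.J x h0 ≤ (αVbar (σ x) : ℝ≥0∞))
    -- the regularity assumption
    (hfeas : P.FeasibilityAssumption h0 σ)
    -- the linear bounds
    (cW aW aVbar aWbar : ℝ) (hcW : 0 < cW) (haW : 0 < aW) (haV : 0 < aVbar) (haWbar : 0 ≤ aWbar)
    (hχ_lin : ∀ s : ℝ≥0, (χW s : ℝ) ≤ cW * s)
    (hα_lin : ∀ s : ℝ≥0, aW * s ≤ (αW s : ℝ))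
    (hαV_lin : ∀ s : ℝ≥0, (αVbar s : ℝ) ≤ aVbar * s)
    (hαW_lin : ∀ s : ℝ≥0, (αWbar s : ℝ) ≤ aWbar * s)
    -- the constants of the bound
    (aY aYlow aYup aYtilde : ℝ)
    (haY : aY = aW / cW) (haYlow : aYlow = aW / cW) (haYup : aYup = aVbar + aWbar / cW)
    (haYtilde : aYtilde = aY / aYup)
    (β : ℝ → ℝ → ℝ)
    (hβ : ∀ s t, β s t = aYup / aYlow * (1 - aYtilde) ^ t * s) :
    -- every iteration is well defined: the sets are nonempty and the minimal cost is attained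
    (∀ i x, (P.H h0 i x).Nonempty ∧ (P.Hr h0 i x).Nonempty ∧ (P.Hstar h0 i x).Nonempty ∧
      ∃ h, IsSelection (P.Hr h0 i) h ∧ P.J x h = P.Vr h0 i x) ∧
    -- the bound is of class KL, and exponential
    (0 < aYtilde ∧ aYtilde ≤ 1) ∧
    IsClassKL β ∧
    (aYtilde < 1 → IsExpKL β) ∧
    (∃ β', IsExpKL β' ∧ ∀ s t : ℝ, 0 ≤ s → 0 ≤ t → β s t ≤ β' s t) ∧
    -- stability, uniformly in the iteration
    (∀ (i : ℕ) (φ : ℕ → Vec nx), P.IsSolution h0 i φ →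
      ∀ k : ℕ, (σ (φ k) : ℝ) ≤ β (σ (φ 0)) k) := by
  have inv := hfeas.iterationInvariant hh0
  obtain rfl : aYlow = aY := haYlow.trans haY.symm
  have haY0 : 0 < aYlow := haY ▸ div_pos haW hcW
  have hup0 : 0 < aYup := by rw [haYup]; positivity
  have haYc : aYlow * cW = aW := by rw [haY]; field_simp
  have hWle : ∀ x, (W x : ℝ) ≤ aWbar * σ x := fun x =>
    (NNReal.coe_le_coe.2 (hdet.W_le x)).trans (hαW_lin _)
  -- Division by `cW` gives the stage cost coefficient `1`, so that it cancels against the decrease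
  -- of `V_r^i`.
  have hdis : ∀ x, ∀ u ∈ P.U x,
      (W (P.f x u) : ℝ) / cW ≤ W x / cW - aYlow * σ x + P.ℓ x u := by
    intro x u hu
    have h₁ := hdet.dissipation x u hu
    have h₂ := hχ_lin (P.ℓ x u)
    have h₃ := hα_lin (σ x)
    rw [div_le_iff₀ hcW]
    have : (W x / cW - aYlow * σ x + P.ℓ x u) * cW = W x - aW * σ x + cW * P.ℓ x u := by
      rw [← haYc]; field_simp
    rw [this]
    linarith
  have hVle : ∀ i x, P.Vr h0 i x ≤ (αVbar (σ x) : ENNReal) := fun i x =>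
    ((inv i).Vr_le x).trans (hV0 x)
  have hVfin : ∀ i x, P.Vr h0 i x ≠ ⊤ := fun i x => ne_top_of_le_ne_top ENNReal.coe_ne_top (hVle i x)
  have hVreal : ∀ i x, (P.Vr h0 i x).toReal ≤ aVbar * σ x := fun i x =>
    (ENNReal.toReal_mono ENNReal.coe_ne_top (hVle i x)).trans (hαV_lin _)
  have hstep : ∀ i x, ∀ u ∈ P.Hstar h0 i x,
      (P.ℓ x u : ℝ) + (P.Vr h0 i (P.f x u)).toReal ≤ (P.Vr h0 i x).toReal := by
    intro i x u hu
    have := ENNReal.toReal_mono (hVfin i x) ((inv i).stage_Hstar_le x u hu)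
    rwa [ControlProblem.stage, ENNReal.toReal_add ENNReal.coe_ne_top (hVfin i _)] at this
  -- the Lyapunov function is `Y = V + W / cW`
  have hYup : ∀ i x, (P.Vr h0 i x).toReal + W x / cW ≤ aYup * σ x := by
    intro i x
    have h₁ : (W x : ℝ) / cW ≤ aWbar * σ x / cW := by gcongr; exact hWle x
    have h₂ : aYup * σ x = aVbar * σ x + aWbar * σ x / cW := by rw [haYup]; ring
    linarith [hVreal i x]
  have hYdec : ∀ i x, ∀ u ∈ P.Hstar h0 i x,
      (P.Vr h0 i (P.f x u)).toReal + W (P.f x u) / cW ≤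
        (P.Vr h0 i x).toReal + W x / cW - aYlow * σ x := by
    intro i x u hu
    linarith [hdis x u ((inv i).Hstar_subset x hu), hstep i x u hu]
  -- The lower bound follows from the decrease itself, because `Y` at the next state is nonnegative.
  have hYlow : ∀ i x, aYlow * σ x ≤ (P.Vr h0 i x).toReal + W x / cW := by
    intro i x
    obtain ⟨u, hu⟩ := (inv i).Hstar_nonempty x
    have h₁ : 0 ≤ (P.Vr h0 i (P.f x u)).toReal + W (P.f x u) / cW := by positivity
    linarith [hYdec i x u hu]
  -- The two bounds on `Y` are compared at a state where `σ` is positive.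
  have hle : aYlow ≤ aYup := by
    obtain ⟨x, hx⟩ := hfeas.exists_pos hnx
    exact le_of_mul_le_mul_right ((hYlow 0 x).trans (hYup 0 x)) (NNReal.coe_pos.2 hx)
  have ht0 : 0 < aYtilde := haYtilde ▸ div_pos haY0 hup0
  have ht1 : aYtilde ≤ 1 := haYtilde ▸ (div_le_one hup0).2 hle
  have hq0 : 0 ≤ 1 - aYtilde := by linarith
  have hq1 : 1 - aYtilde < 1 := by linarith
  have hc : 1 ≤ aYup / aYlow := (one_le_div haY0).2 hle
  obtain rfl : β = fun s t => aYup / aYlow * (1 - aYtilde) ^ t * s :=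
    funext fun s => funext fun t => hβ s t
  refine ⟨fun i x => ⟨(inv i).H_nonempty x, (inv i).Hr_nonempty x, (inv i).Hstar_nonempty x,
      (inv i).exists_optimal.imp fun h hh => ⟨hh.1, hh.2 x⟩⟩, ⟨ht0, ht1⟩,
    isClassKL_mul_rpow (by linarith) hq0 hq1,
    fun ht => isExpKL_mul_rpow hc (by linarith) hq1,
    exists_isExpKL_mul_rpow_le hc hq0 hq1, ?_⟩
  intro i φ hφ k
  have hY := le_pow_mul_of_succ_le (Y := fun k => (P.Vr h0 i (φ k)).toReal + W (φ k) / cW) hq0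
    (fun k => by
      obtain ⟨u, hu, hnext⟩ := hφ k
      have h₁ := hYdec i (φ k) u hu
      -- The upper bound on `Y` turns the decrease `aY σ` into the proportional decrease `aYtilde
      -- Y`.
      have h₂ : aYtilde * ((P.Vr h0 i (φ k)).toReal + W (φ k) / cW) ≤ aYlow * σ (φ k) := by
        refine (mul_le_mul_of_nonneg_left (hYup i (φ k)) ht0.le).trans_eq ?_
        rw [haYtilde]; field_simp
      rw [← hnext] at h₁
      linarith) k
  have hfinal : aYlow * σ (φ k) ≤ (1 - aYtilde) ^ k * (aYup * σ (φ 0)) :=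
    (hYlow i (φ k)).trans (hY.trans (mul_le_mul_of_nonneg_left (hYup i (φ 0)) (by positivity)))
  dsimp only
  rw [Real.rpow_natCast]
  calc (σ (φ k) : ℝ) ≤ (1 - aYtilde) ^ k * (aYup * σ (φ 0)) / aYlow := by
        rw [le_div_iff₀ haY0, mul_comm]; exact hfinal
    _ = aYup / aYlow * (1 - aYtilde) ^ k * σ (φ 0) := by ring
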